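/- For a real $n\times n$ matrix $X$ write $\operatorname{sym}X=\frac12(X+X^T)$, $\operatorname{skew}X=\frac12(X-X^T)$ and $\|X\|^2=\operatorname{tr}(X^TX)$. For $F\in\mathrm{GL}^+(3)$, i.e. $F \in\mathbb{R}^{3\times 3}$ with $\det F>0$, the reduced Cosserat shear--stretch energy is $$W^{\rm red}_{1,0}(F)=\min_{R\in \mathrm{SO}(3)}\widehat W_{1,0}(R;F),\qquad \widehat W_{\mu,\mu_c}(R;F)=\mu\,\|\operatorname{sym}(RF-\mathbb 1)\|^2+\mu_c\,\|\operatorname{skew}(RF-\mathbb 1)\|^2 .$$ Let $U=\sqrt{F^TF}$ be the positive definite square root of $F^TF$. With $s^{\rm mmp}(F)=\max_{i\ne j}\frac{(\sigma_i-1)+(\sigma_j-1)}2$, where $\sigma_1,\sigma_2,\sigma_3$ are the singular values of $F$, and $\lambda_{\mu,\mu_c}=\frac{\mu}{\mu-\mu_c}$ for $\mu>\mu_c\ge 0$, let $$\mathrm{Dom}^{\rm C}_{\mu,\mu_c}=\{F\in\mathrm{GL}^+(3): s^{\rm mmp}(\lambda_{\mu,\mu_c}^{-1}F)\le 0\},\qquad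 \mathrm{Dom}^{\rm NC}_{\mu,\mu_c}=\{F\in\mathrm{GL}^+(3): s^{\rm mmp}(\lambda_{\mu,\mu_c}^{-1}F)\ge 0\}.$$ **Lemma.** Let $F\in\mathrm{GL}^+(3)$ have ordered singular values $\sigma_1>\sigma_2>\sigma_3>0$. Then the minimum defining $W^{\rm red}_{1,0}(F)$ is attained, and $$W^{\rm red}_{1,0}(F)=\begin{cases}(\sigma_1-1)^2+(\sigma_2-1)^2+(\sigma_3-1)^2=\|U-\mathbb 1\|^2, & \text{if } \sigma_1+\sigma_2\le 2,\text{ i.e., } F\in\mathrm{Dom}^{\rm C}_{1,0},\\[2pt] \frac12(\sigma_1-\sigma_2)^2+(\sigma_3-1)^2, & \text{if }\sigma_1+\sigma_2\ge 2,\text{ i.e., } F\in\mathrm{Dom}^{\rm NC}_{1,0}.\end{cases}$$ -/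

import Mathlib

/-!
The Cosserat shear--stretch energy, its reduced energy, the singular values and the right
Biot stretch tensor of a deformation gradient.
-/

namespace Cosserat

open Matrix
open scoped MatrixGroups

/-- The symmetric part `sym X = (X + Xᵀ) / 2`. -/
noncomputable def symPart {n : ℕ} (X : Matrix (Fin n) (Fin n) ℝ) : Matrix (Fin n) (Fin n) ℝ :=
  (1 / 2 : ℝ) • (X + Xᵀ)

/-- The skew-symmetric part `skew X = (X - Xᵀ) / 2`. -/
noncomputable def skewPart {n : ℕ} (X : Matrix (Fin n) (Fin n) ℝ) : Matrix (Fin n) (Fin n) ℝ :=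
  (1 / 2 : ℝ) • (X - Xᵀ)

/-- The scalar product `⟨X, Y⟩ = tr (Xᵀ Y)` of real matrices. -/
def scalProd {n : ℕ} (X Y : Matrix (Fin n) (Fin n) ℝ) : ℝ :=
  (Xᵀ * Y).trace

/-- The squared Frobenius norm `‖X‖² = ⟨X, X⟩`. -/
def frobSq {n : ℕ} (X : Matrix (Fin n) (Fin n) ℝ) : ℝ :=
  scalProd X X

/-- The squared Frobenius norm is the sum of the squares of the entries. -/
theorem frobSq_eq_sum {n : ℕ} (X : Matrix (Fin n) (Fin n) ℝ) :
    frobSq X = ∑ i, ∑ j, X i j ^ 2 := by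
  rw [Finset.sum_comm]
  simp [frobSq, scalProd, Matrix.trace, Matrix.mul_apply, sq]

/-- The Cosserat shear--stretch energy
`W_{μ,μc}(R ; F) = μ ‖sym (Rᵀ F - 1)‖² + μc ‖skew (Rᵀ F - 1)‖²`. -/
noncomputable def energy {n : ℕ} (μ μc : ℝ) (R F : Matrix (Fin n) (Fin n) ℝ) : ℝ :=
  μ * frobSq (symPart (Rᵀ * F - 1)) + μc * frobSq (skewPart (Rᵀ * F - 1))

/-- The energy of the relative rotation, `Ŵ_{μ,μc}(R ; F) = W_{μ,μc}(Rᵀ ; F)`. -/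
noncomputable def energyRel {n : ℕ} (μ μc : ℝ) (R F : Matrix (Fin n) (Fin n) ℝ) : ℝ :=
  energy μ μc Rᵀ F

/-- The underlying matrix of an element of `GL⁺(n)`. -/
def toMat {n : ℕ} (F : GL(n, ℝ)⁺) : Matrix (Fin n) (Fin n) ℝ :=
  ((F : GL (Fin n) ℝ) : Matrix (Fin n) (Fin n) ℝ)

/-- The reduced Cosserat shear--stretch energy, the minimum of `Ŵ_{μ,μc}(R ; F)` over
`R ∈ SO(n)`, written as an infimum. -/
noncomputable def reducedEnergy {n : ℕ} (μ μc : ℝ) (F : GL(n, ℝ)⁺) : ℝ :=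
  ⨅ R : Matrix.specialOrthogonalGroup (Fin n) ℝ, energyRel μ μc (R : Matrix (Fin n) (Fin n) ℝ)
    (toMat F)

/-- The singular values of a matrix in decreasing order; the index starts at `0`, so that
`singularValue X 0` is the largest one. -/
noncomputable def singularValue {n : ℕ} (X : Matrix (Fin n) (Fin n) ℝ) (i : Fin n) : ℝ :=
  (Matrix.toEuclideanLin X).singularValues (i : ℕ)

open scoped MatrixOrder in
/-- The right Biot stretch tensor `U(F) = √(Fᵀ F)`, the positive semidefinite square root. -/
noncomputable def stretch {n : ℕ} (X : Matrix (Fin n) (Fin n) ℝ) : Matrix (Fin n) (Fin n) ℝ :=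
  CFC.sqrt (Xᵀ * X)

/-- The maximal mean planar strain, the maximum of `((σ_i - 1) + (σ_j - 1)) / 2` over `i ≠ j`. -/
noncomputable def maxMeanPlanarStrain {n : ℕ} (X : Matrix (Fin n) (Fin n) ℝ) : ℝ :=
  ⨆ p : {p : Fin n × Fin n // p.1 ≠ p.2},
    ((singularValue X p.1.1 - 1) + (singularValue X p.1.2 - 1)) / 2

/-- The induced scaling parameter `λ_{μ,μc} = μ / (μ - μc)`. -/
noncomputable def scalingParam (μ μc : ℝ) : ℝ :=
  μ / (μ - μc)

/-- The classical domain: those `F` for which the rescaled deformation gradient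
`λ_{μ,μc}⁻¹ F` has nonpositive maximal mean planar strain. -/
def domClassical {n : ℕ} (μ μc : ℝ) : Set GL(n, ℝ)⁺ :=
  {F | maxMeanPlanarStrain ((scalingParam μ μc)⁻¹ • toMat F) ≤ 0}

/-- The non-classical domain: those `F` for which the rescaled deformation gradient
`λ_{μ,μc}⁻¹ F` has nonnegative maximal mean planar strain. -/
def domNonclassical {n : ℕ} (μ μc : ℝ) : Set GL(n, ℝ)⁺ :=
  {F | 0 ≤ maxMeanPlanarStrain ((scalingParam μ μc)⁻¹ • toMat F)}

end Cosserat

/-!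
The lower bound rests on Euler's parametrization of a rotation `S`: the four numbers
`1 ± S₀₀ ± S₁₁ ± S₂₂` with an even number of minus signs are nonnegative, and the energy of `S D`
with `D` diagonal depends on the diagonal of `S` only.
-/

namespace Cosserat

open Matrix
open scoped MatrixGroups

/-! ### Invariance of the energy under orthogonal conjugation -/

section Conjugation

variable {n : ℕ}

/-! In an orthonormal frame of right singular vectors of `F`, the matrices `R F` become exactly the
matrices `S D`, with `S` a rotation and `D` the diagonal matrix of singular values `d`
(`range_energyRel_one_zero`). Column norms and principal minors of `S` remove all off-diagonal
entries from `‖sym (S D - 1)‖²`. With `u = tr (D - S D) / 2 ≥ 0` what remains is `∑ (d i - 1)² +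
2u(u + 2 - (d 0 + d 1))` plus nonnegative multiples of two squared Euler parameters
(`le_frobSq_symPart_mul_diagonal_sub_one`). On `u ≥ 0` the quadratic is least at `u = 0` if `d 0 + d
1 ≤ 2`, and otherwise at `u = (d 0 + d 1 - 2) / 2`. Both values are reached with the extra terms
zero: by `S = 1`, and by a rotation in the plane of the two largest singular values. -/

theorem symPart_conj (V X : Matrix (Fin n) (Fin n) ℝ) :
    symPart (Vᵀ * X * V) = Vᵀ * symPart X * V := by
  simp [symPart, Matrix.mul_add, Matrix.add_mul, Matrix.mul_assoc]

theorem frobSq_conj {V : Matrix (Fin n) (Fin n) ℝ} (hV : Vᵀ * V = 1)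
    (X : Matrix (Fin n) (Fin n) ℝ) : frobSq (Vᵀ * X * V) = frobSq X := by
  have hV' : V * Vᵀ = 1 := mul_eq_one_comm.mp hV
  have h : (Vᵀ * X * V)ᵀ * (Vᵀ * X * V) = Vᵀ * (Xᵀ * X * V) := by
    calc (Vᵀ * X * V)ᵀ * (Vᵀ * X * V) = Vᵀ * (Xᵀ * (V * Vᵀ) * X * V) := by
          simp [Matrix.mul_assoc]
      _ = _ := by rw [hV', Matrix.mul_one]
  rw [frobSq, scalProd, h, Matrix.trace_mul_comm, Matrix.mul_assoc, hV', Matrix.mul_one]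
  rfl

theorem frobSq_symPart_sub_one_conj {V : Matrix (Fin n) (Fin n) ℝ} (hV : Vᵀ * V = 1)
    (X : Matrix (Fin n) (Fin n) ℝ) :
    frobSq (symPart (Vᵀ * X * V - 1)) = frobSq (symPart (X - 1)) := by
  have h : Vᵀ * X * V - 1 = Vᵀ * (X - 1) * V := by
    rw [Matrix.mul_sub, Matrix.sub_mul, Matrix.mul_one, hV]
  rw [h, symPart_conj, frobSq_conj hV]

theorem energyRel_one_zero (R F : Matrix (Fin n) (Fin n) ℝ) :
    energyRel 1 0 R F = frobSq (symPart (R * F - 1)) := by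
  simp [energyRel, energy]

end Conjugation

/-! ### Singular values, stretch tensor and planar strain -/

section SingularValues

variable {n : ℕ}

/-- Right singular vectors: `Xᵀ X` is diagonalized by an orthogonal matrix, with the squares of
the ordered singular values on the diagonal. -/
theorem exists_conj_transpose_mul_self_eq_diagonal (X : Matrix (Fin n) (Fin n) ℝ) :
    ∃ V : Matrix (Fin n) (Fin n) ℝ, Vᵀ * V = 1 ∧
      Vᵀ * (Xᵀ * X) * V = diagonal fun i => singularValue X i ^ 2 := by
  set T := Matrix.toEuclideanLin X with hT
  have hn : Module.finrank ℝ (EuclideanSpace ℝ (Fin n)) = n := finrank_euclideanSpace_fin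
  set b := T.isSymmetric_adjoint_comp_self.eigenvectorBasis hn with hb
  have hV : (Matrix.of fun i j => b j i)ᵀ * (Matrix.of fun i j => b j i) =
      (1 : Matrix (Fin n) (Fin n) ℝ) := by
    ext i j
    have := b.inner_eq_ite i j
    simp only [PiLp.inner_apply, RCLike.inner_apply, conj_trivial] at this
    simp only [Matrix.mul_apply, Matrix.transpose_apply, Matrix.of_apply, Matrix.one_apply, ← this]
    exact Finset.sum_congr rfl fun _ _ => mul_comm _ _
  refine ⟨Matrix.of fun i j => b j i, hV, ?_⟩
  have hXV : (Xᵀ * X) * (Matrix.of fun i j => b j i) =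
      (Matrix.of fun i j => b j i) * diagonal fun i => singularValue X i ^ 2 := by
    ext i j
    have h := T.isSymmetric_adjoint_comp_self.apply_eigenvectorBasis hn j
    rw [← T.sq_singularValues_fin hn j, ← hb, LinearMap.comp_apply, hT,
      ← Matrix.toEuclideanLin_conjTranspose_eq_adjoint] at h
    have h' := congrArg (fun v : EuclideanSpace ℝ (Fin n) => v i) h
    simp only [Matrix.ofLp_toLpLin, Matrix.toLin'_apply, Matrix.mulVec_mulVec,
      Matrix.conjTranspose_eq_transpose_of_trivial] at h'
    rw [Matrix.mul_diagonal]
    simpa [Matrix.mul_apply, Matrix.mulVec, dotProduct, mul_comm, singularValue] using h'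
  rw [Matrix.mul_assoc, hXV, ← Matrix.mul_assoc, hV, Matrix.one_mul]

theorem singularValue_nonneg (X : Matrix (Fin n) (Fin n) ℝ) (i : Fin n) :
    0 ≤ singularValue X i :=
  LinearMap.singularValues_nonneg _ _

open scoped MatrixOrder in
-- By uniqueness of the positive semidefinite square root: `V * D * Vᵀ` is positive semidefinite and
-- squares to `Xᵀ * X`.
theorem conj_stretch_eq_diagonal {X V : Matrix (Fin n) (Fin n) ℝ} (hV : Vᵀ * V = 1)
    (hX : Vᵀ * (Xᵀ * X) * V = diagonal fun i => singularValue X i ^ 2) :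
    Vᵀ * stretch X * V = diagonal fun i => singularValue X i := by
  have hV' : V * Vᵀ = 1 := mul_eq_one_comm.mp hV
  set D := diagonal fun i => singularValue X i with hD
  have hXX : Xᵀ * X = (V * D * Vᵀ) * (V * D * Vᵀ) := by
    have hDD : Vᵀ * (Xᵀ * X) * V = D * D := by
      rw [hX, hD, Matrix.diagonal_mul_diagonal]
      simp [sq]
    calc Xᵀ * X = (V * Vᵀ) * (Xᵀ * X) * (V * Vᵀ) := by simp [hV']
      _ = V * (Vᵀ * (Xᵀ * X) * V) * Vᵀ := by simp only [Matrix.mul_assoc]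
      _ = V * D * (Vᵀ * V) * D * Vᵀ := by rw [hDD, hV]; simp only [Matrix.mul_assoc, Matrix.one_mul]
      _ = _ := by simp only [Matrix.mul_assoc]
  have hpos : 0 ≤ V * D * Vᵀ := by
    rw [Matrix.nonneg_iff_posSemidef]
    exact (Matrix.PosSemidef.diagonal fun i => singularValue_nonneg X i).mul_mul_conjTranspose_same V
  have hs : stretch X = V * D * Vᵀ := CFC.sqrt_unique hXX.symm hpos
  calc Vᵀ * stretch X * V = (Vᵀ * V) * D * (Vᵀ * V) := by rw [hs]; simp only [Matrix.mul_assoc]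
    _ = D := by simp [hV]

theorem frobSq_stretch_sub_one (X : Matrix (Fin n) (Fin n) ℝ) :
    frobSq (stretch X - 1) = ∑ i, (singularValue X i - 1) ^ 2 := by
  obtain ⟨V, hV, hX⟩ := exists_conj_transpose_mul_self_eq_diagonal X
  have h : Vᵀ * (stretch X - 1) * V = diagonal fun i => singularValue X i - 1 := by
    rw [Matrix.mul_sub, Matrix.sub_mul, conj_stretch_eq_diagonal hV hX, Matrix.mul_one, hV,
      ← Matrix.diagonal_one, Matrix.diagonal_sub]
  rw [← frobSq_conj hV, h, frobSq, scalProd, Matrix.diagonal_transpose,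
    Matrix.diagonal_mul_diagonal, Matrix.trace_diagonal]
  simp [sq]

theorem singularValue_antitone (X : Matrix (Fin n) (Fin n) ℝ) :
    Antitone (singularValue X) :=
  fun _ _ h => LinearMap.singularValues_antitone _ h

theorem maxMeanPlanarStrain_fin_three (X : Matrix (Fin 3) (Fin 3) ℝ) :
    maxMeanPlanarStrain X = (singularValue X 0 + singularValue X 1) / 2 - 1 := by
  have h₁ : singularValue X 1 ≤ singularValue X 0 := singularValue_antitone X (by decide)
  have h₂ : singularValue X 2 ≤ singularValue X 1 := singularValue_antitone X (by decide)
  have : Nonempty {p : Fin 3 × Fin 3 // p.1 ≠ p.2} := ⟨⟨(0, 1), by decide⟩⟩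
  apply le_antisymm
  · refine ciSup_le ?_
    rintro ⟨⟨i, j⟩, hij⟩
    fin_cases i <;> fin_cases j <;> simp at hij ⊢ <;> linarith
  · refine le_trans (le_of_eq ?_)
      (le_ciSup (Set.finite_range _).bddAbove (⟨(0, 1), by decide⟩ : {p : Fin 3 × Fin 3 // p.1 ≠ p.2}))
    simp only
    ring

end SingularValues

/-! ### Entries of a rotation and the lower bound -/

section Rotation

variable {S : Matrix (Fin 3) (Fin 3) ℝ}

theorem adjugate_eq_transpose_of_mem_specialOrthogonal (h : Sᵀ * S = 1) (hdet : S.det = 1) :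
    S.adjugate = Sᵀ := by
  calc S.adjugate = Sᵀ * S * S.adjugate := by rw [h, Matrix.one_mul]
    _ = Sᵀ := by rw [Matrix.mul_assoc, Matrix.mul_adjugate, hdet, one_smul, Matrix.mul_one]

/-- The diagonal entries of a rotation are, up to products of opposite off-diagonal entries,
the principal minors. -/
theorem principal_minors_of_mem_specialOrthogonal (h : Sᵀ * S = 1) (hdet : S.det = 1) :
    S 1 1 * S 2 2 - S 1 2 * S 2 1 = S 0 0 ∧ S 0 0 * S 2 2 - S 0 2 * S 2 0 = S 1 1 ∧
      S 0 0 * S 1 1 - S 0 1 * S 1 0 = S 2 2 := by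
  have hadj := adjugate_eq_transpose_of_mem_specialOrthogonal h hdet
  rw [Matrix.adjugate_fin_three] at hadj
  exact ⟨by simpa using congrFun (congrFun hadj 0) 0, by simpa using congrFun (congrFun hadj 1) 1,
    by simpa using congrFun (congrFun hadj 2) 2⟩

theorem col_norms_of_transpose_mul_self (h : Sᵀ * S = 1) :
    S 0 0 ^ 2 + S 1 0 ^ 2 + S 2 0 ^ 2 = 1 ∧ S 0 1 ^ 2 + S 1 1 ^ 2 + S 2 1 ^ 2 = 1 ∧
      S 0 2 ^ 2 + S 1 2 ^ 2 + S 2 2 ^ 2 = 1 := by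
  refine ⟨?_, ?_, ?_⟩
  · simpa [Matrix.mul_apply, Fin.sum_univ_three, sq] using congrFun (congrFun h 0) 0
  · simpa [Matrix.mul_apply, Fin.sum_univ_three, sq] using congrFun (congrFun h 1) 1
  · simpa [Matrix.mul_apply, Fin.sum_univ_three, sq] using congrFun (congrFun h 2) 2

/-- Two of the squared Euler parameters of a rotation are nonnegative. -/
theorem euler_parameters_nonneg (h : Sᵀ * S = 1) (hdet : S.det = 1) :
    0 ≤ 1 + S 0 0 - S 1 1 - S 2 2 ∧ 0 ≤ 1 - S 0 0 + S 1 1 - S 2 2 := by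
  obtain ⟨m₀, m₁, m₂⟩ := principal_minors_of_mem_specialOrthogonal h hdet
  obtain ⟨c₀, c₁, c₂⟩ := col_norms_of_transpose_mul_self h
  obtain ⟨r₀, r₁, r₂⟩ := col_norms_of_transpose_mul_self (S := Sᵀ) (by
    rw [Matrix.transpose_transpose]; exact mul_eq_one_comm.mp h)
  simp only [Matrix.transpose_apply] at r₀ r₁ r₂
  -- One column norm minus two row norms, as in `c₂ - r₀ - r₁`, cancels the entries shared by that
  -- column and those rows; the minor supplies the product of the remaining off-diagonal pair.
  have h01 : (1 + S 0 0 - S 1 1 - S 2 2) * (1 - S 0 0 + S 1 1 - S 2 2) =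
      (S 0 1 + S 1 0) ^ 2 := by linear_combination c₂ - r₀ - r₁ + 2 * m₂
  have h02 : (1 + S 0 0 - S 1 1 - S 2 2) * (1 - S 0 0 - S 1 1 + S 2 2) =
      (S 0 2 + S 2 0) ^ 2 := by linear_combination c₁ - r₀ - r₂ + 2 * m₁
  have h03 : (1 + S 0 0 - S 1 1 - S 2 2) * (1 + S 0 0 + S 1 1 + S 2 2) =
      (S 1 2 - S 2 1) ^ 2 := by linear_combination c₀ - r₁ - r₂ - 2 * m₀
  have h12 : (1 - S 0 0 + S 1 1 - S 2 2) * (1 - S 0 0 - S 1 1 + S 2 2) =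
      (S 1 2 + S 2 1) ^ 2 := by linear_combination c₀ - r₁ - r₂ + 2 * m₀
  have h13 : (1 - S 0 0 + S 1 1 - S 2 2) * (1 + S 0 0 + S 1 1 + S 2 2) =
      (S 0 2 - S 2 0) ^ 2 := by linear_combination c₁ - r₀ - r₂ - 2 * m₁
  -- The four parameters sum to 4, so four times one of them is its square plus its products with
  -- the other three, all of which are squares.
  constructor
  · linarith [sq_nonneg (S 0 1 + S 1 0), sq_nonneg (S 0 2 + S 2 0), sq_nonneg (S 1 2 - S 2 1),
      sq_nonneg (1 + S 0 0 - S 1 1 - S 2 2)]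
  · linarith [sq_nonneg (S 0 1 + S 1 0), sq_nonneg (S 1 2 + S 2 1), sq_nonneg (S 0 2 - S 2 0),
      sq_nonneg (1 - S 0 0 + S 1 1 - S 2 2)]

theorem frobSq_symPart_mul_diagonal_sub_one (S : Matrix (Fin 3) (Fin 3) ℝ) (d : Fin 3 → ℝ) :
    frobSq (symPart (S * diagonal d - 1)) =
      (S 0 0 * d 0 - 1) ^ 2 + (S 1 1 * d 1 - 1) ^ 2 + (S 2 2 * d 2 - 1) ^ 2 +
        ((S 0 1 * d 1 + S 1 0 * d 0) ^ 2 + (S 0 2 * d 2 + S 2 0 * d 0) ^ 2 +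
          (S 1 2 * d 2 + S 2 1 * d 1) ^ 2) / 2 := by
  simp only [frobSq_eq_sum, symPart, Fin.sum_univ_three, Matrix.smul_apply, Matrix.add_apply,
    Matrix.sub_apply, Matrix.transpose_apply, Matrix.mul_diagonal, Matrix.one_apply, smul_eq_mul]
  simp
  ring

/-- The energy of a rotation of a diagonal stretch is bounded below by a quadratic polynomial in
`(tr D - tr (S D)) / 2`. -/
theorem le_frobSq_symPart_mul_diagonal_sub_one (h : Sᵀ * S = 1) (hdet : S.det = 1)
    {d : Fin 3 → ℝ} (h₀₁ : d 1 ≤ d 0) (h₁₂ : d 2 ≤ d 1) (h₂ : 0 ≤ d 2) {u : ℝ}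
    (hu : u = (d 0 * (1 - S 0 0) + d 1 * (1 - S 1 1) + d 2 * (1 - S 2 2)) / 2) :
    (d 0 - 1) ^ 2 + (d 1 - 1) ^ 2 + (d 2 - 1) ^ 2 + 2 * u * (u + 2 - (d 0 + d 1)) ≤
      frobSq (symPart (S * diagonal d - 1)) := by
  obtain ⟨m₀, m₁, m₂⟩ := principal_minors_of_mem_specialOrthogonal h hdet
  obtain ⟨c₀, c₁, c₂⟩ := col_norms_of_transpose_mul_self h
  obtain ⟨p₀, p₁⟩ := euler_parameters_nonneg h hdet
  have q₀ := mul_nonneg p₀ (mul_nonneg (by linarith : 0 ≤ d 1 + d 2) (by linarith : 0 ≤ d 0 - d 2))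
  have q₁ := mul_nonneg p₁ (mul_nonneg (by linarith : 0 ≤ d 0 + d 2) (by linarith : 0 ≤ d 1 - d 2))
  have key : frobSq (symPart (S * diagonal d - 1)) =
      (d 0 - 1) ^ 2 + (d 1 - 1) ^ 2 + (d 2 - 1) ^ 2 + 2 * u * (u + 2 - (d 0 + d 1)) +
        ((1 + S 0 0 - S 1 1 - S 2 2) * ((d 1 + d 2) * (d 0 - d 2)) +
          (1 - S 0 0 + S 1 1 - S 2 2) * ((d 0 + d 2) * (d 1 - d 2))) / 2 := by
    rw [frobSq_symPart_mul_diagonal_sub_one, hu]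
    linear_combination (d 0 ^ 2 * c₀ + d 1 ^ 2 * c₁ + d 2 ^ 2 * c₂) / 2 -
      d 1 * d 2 * m₀ - d 0 * d 2 * m₁ - d 0 * d 1 * m₂
  linarith

end Rotation

end Cosserat

namespace Cosserat

open Matrix
open scoped MatrixGroups

/-! ### Reduction to a diagonal stretch -/

section Relative

variable {n : ℕ}

theorem mem_specialOrthogonalGroup_iff_transpose_mul_self {R : Matrix (Fin n) (Fin n) ℝ} :
    R ∈ Matrix.specialOrthogonalGroup (Fin n) ℝ ↔ Rᵀ * R = 1 ∧ R.det = 1 := by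
  rw [Matrix.mem_specialOrthogonalGroup_iff, Matrix.mem_orthogonalGroup_iff']

/-- Two matrices with positive determinant and the same Gram matrix differ by a rotation. -/
theorem exists_rotation_mul_eq {A B : Matrix (Fin n) (Fin n) ℝ} (hA : 0 < A.det) (hB : 0 < B.det)
    (h : Aᵀ * A = Bᵀ * B) :
    ∃ R ∈ Matrix.specialOrthogonalGroup (Fin n) ℝ, R * A = B := by
  have hAu : IsUnit A.det := hA.ne'.isUnit
  have hR : B * A⁻¹ * A = B := by
    rw [Matrix.mul_assoc, Matrix.nonsing_inv_mul _ hAu, Matrix.mul_one]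
  have hort : (B * A⁻¹)ᵀ * (B * A⁻¹) = 1 := by
    calc (B * A⁻¹)ᵀ * (B * A⁻¹) = A⁻¹ᵀ * (Bᵀ * B) * A⁻¹ := by
          simp only [Matrix.transpose_mul, Matrix.mul_assoc]
      _ = (A * A⁻¹)ᵀ * (A * A⁻¹) := by
          rw [← h]; simp only [Matrix.transpose_mul, Matrix.mul_assoc]
      _ = 1 := by simp [Matrix.mul_nonsing_inv _ hAu]
  have hdet : (B * A⁻¹).det = 1 := by
    have h₁ : (B * A⁻¹).det * (B * A⁻¹).det = 1 := by
      have := congrArg Matrix.det hort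
      rwa [Matrix.det_mul, Matrix.det_transpose, Matrix.det_one] at this
    have h₂ : 0 < (B * A⁻¹).det := by
      have : 0 < (B * A⁻¹).det * A.det := by rwa [← Matrix.det_mul, hR]
      exact pos_of_mul_pos_left this hA.le
    nlinarith
  exact ⟨B * A⁻¹, mem_specialOrthogonalGroup_iff_transpose_mul_self.mpr ⟨hort, hdet⟩, hR⟩

/-- In the frame of the right singular vectors of `F` the energies of the rotations are those of
the rotations of the diagonal matrix of singular values. -/
theorem range_energyRel_one_zero {F : Matrix (Fin n) (Fin n) ℝ} (hF : 0 < F.det)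
    (hσ : ∀ i, 0 < singularValue F i) :
    (Set.range fun R : Matrix.specialOrthogonalGroup (Fin n) ℝ =>
        energyRel 1 0 (R : Matrix (Fin n) (Fin n) ℝ) F) =
      Set.range fun S : Matrix.specialOrthogonalGroup (Fin n) ℝ =>
        frobSq (symPart ((S : Matrix (Fin n) (Fin n) ℝ) * diagonal (singularValue F) - 1)) := by
  obtain ⟨V, hV, hX⟩ := exists_conj_transpose_mul_self_eq_diagonal F
  have hV' : V * Vᵀ = 1 := mul_eq_one_comm.mp hV
  -- `V` may be a reflection: conjugation only involves the square of its determinant.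
  have hVdet : V.det * V.det = 1 := by simpa using congrArg Matrix.det hV
  set D := diagonal (singularValue F) with hD
  have hDdet : 0 < D.det := by
    rw [hD, Matrix.det_diagonal]; exact Finset.prod_pos fun i _ => hσ i
  have hDD : Dᵀ * D = Vᵀ * (Fᵀ * F) * V := by
    rw [hX, hD, Matrix.diagonal_transpose, Matrix.diagonal_mul_diagonal]
    simp [sq]
  -- Serves both inclusions, with `W = V` to pass from `R` to `S` and `W = Vᵀ` to return.
  have gram {A B : Matrix (Fin n) (Fin n) ℝ} {W : Matrix (Fin n) (Fin n) ℝ} (hW : W * Wᵀ = 1)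
      {R : Matrix (Fin n) (Fin n) ℝ} (hR : R ∈ Matrix.specialOrthogonalGroup (Fin n) ℝ)
      (hAB : Bᵀ * B = Wᵀ * (Aᵀ * A) * W) :
      Bᵀ * B = (Wᵀ * (R * A) * W)ᵀ * (Wᵀ * (R * A) * W) := by
    have hR := (mem_specialOrthogonalGroup_iff_transpose_mul_self.mp hR).1
    calc Bᵀ * B = Wᵀ * (Aᵀ * (Rᵀ * R) * A) * W := by rw [hAB, hR, Matrix.mul_one]
      _ = Wᵀ * Aᵀ * Rᵀ * (W * Wᵀ) * R * A * W := by
        rw [hW, Matrix.mul_one]; simp only [Matrix.mul_assoc]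
      _ = _ := by
        simp only [Matrix.transpose_mul, Matrix.transpose_transpose, Matrix.mul_assoc]
  have hdet {R A : Matrix (Fin n) (Fin n) ℝ} (hR : R ∈ Matrix.specialOrthogonalGroup (Fin n) ℝ)
      {W : Matrix (Fin n) (Fin n) ℝ} (hW : W.det * W.det = 1) (hA : 0 < A.det) :
      0 < (Wᵀ * (R * A) * W).det := by
    have hR := (mem_specialOrthogonalGroup_iff_transpose_mul_self.mp hR).2
    rw [Matrix.det_mul, Matrix.det_mul, Matrix.det_mul, Matrix.det_transpose, hR, one_mul,
      mul_right_comm, hW, one_mul]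
    exact hA
  ext x
  simp only [Set.mem_range, energyRel_one_zero]
  constructor
  · rintro ⟨R, rfl⟩
    obtain ⟨S, hS, hSD⟩ := exists_rotation_mul_eq hDdet (hdet R.2 hVdet hF) (gram hV' R.2 hDD)
    refine ⟨⟨S, hS⟩, ?_⟩
    simp only [hSD, frobSq_symPart_sub_one_conj hV]
  · rintro ⟨S, rfl⟩
    have hFF : Fᵀ * F = Vᵀᵀ * (Dᵀ * D) * Vᵀ := by
      calc Fᵀ * F = (V * Vᵀ) * (Fᵀ * F) * (V * Vᵀ) := by simp [hV']
        _ = _ := by rw [hDD]; simp only [Matrix.transpose_transpose, Matrix.mul_assoc]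
    obtain ⟨R, hR, hRF⟩ := exists_rotation_mul_eq hF
      (hdet S.2 (W := Vᵀ) (by rwa [Matrix.det_transpose]) hDdet)
      (gram (by rwa [Matrix.transpose_transpose]) S.2 hFF)
    refine ⟨⟨R, hR⟩, ?_⟩
    simp only [hRF]
    exact frobSq_symPart_sub_one_conj (by rwa [Matrix.transpose_transpose]) _

end Relative

/-! ### Minimization for a diagonal stretch -/

section ReducedEnergy

variable {d : Fin 3 → ℝ}

/-- Diagonal entries of a rotation are at most 1, so `u ≥ 0`; then both factors of `2u(u + 2 - (d 0
+ d 1))` are nonnegative. -/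
theorem isLeast_energy_diagonal_of_add_le_two (h₀₁ : d 1 ≤ d 0) (h₁₂ : d 2 ≤ d 1) (h₂ : 0 ≤ d 2)
    (h : d 0 + d 1 ≤ 2) :
    IsLeast (Set.range fun S : Matrix.specialOrthogonalGroup (Fin 3) ℝ =>
        frobSq (symPart ((S : Matrix (Fin 3) (Fin 3) ℝ) * diagonal d - 1)))
      ((d 0 - 1) ^ 2 + (d 1 - 1) ^ 2 + (d 2 - 1) ^ 2) := by
  constructor
  · refine ⟨1, ?_⟩
    simp only [OneMemClass.coe_one]
    rw [frobSq_symPart_mul_diagonal_sub_one]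
    simp
  · rintro _ ⟨S, rfl⟩
    obtain ⟨hS, hdet⟩ := mem_specialOrthogonalGroup_iff_transpose_mul_self.mp S.2
    refine le_trans ?_ (le_frobSq_symPart_mul_diagonal_sub_one hS hdet h₀₁ h₁₂ h₂ rfl)
    obtain ⟨c₀, c₁, c₂⟩ := col_norms_of_transpose_mul_self hS
    set T : Matrix (Fin 3) (Fin 3) ℝ := S.1
    have t₀ : T 0 0 ≤ 1 := by nlinarith [sq_nonneg (T 1 0), sq_nonneg (T 2 0)]
    have t₁ : T 1 1 ≤ 1 := by nlinarith [sq_nonneg (T 0 1), sq_nonneg (T 2 1)]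
    have t₂ : T 2 2 ≤ 1 := by nlinarith [sq_nonneg (T 0 2), sq_nonneg (T 1 2)]
    have hu : 0 ≤ (d 0 * (1 - T 0 0) + d 1 * (1 - T 1 1) + d 2 * (1 - T 2 2)) / 2 := by
      have := mul_nonneg (by linarith : 0 ≤ d 0) (sub_nonneg.mpr t₀)
      have := mul_nonneg (by linarith : 0 ≤ d 1) (sub_nonneg.mpr t₁)
      have := mul_nonneg h₂ (sub_nonneg.mpr t₂)
      linarith
    have := mul_nonneg (mul_nonneg zero_le_two hu) (by linarith : 0 ≤ (d 0 * (1 - T 0 0) +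
      d 1 * (1 - T 1 1) + d 2 * (1 - T 2 2)) / 2 + 2 - (d 0 + d 1))
    linarith

/-- The minimum is attained at the rotation about the third axis by the angle
`arccos (2 / (d 0 + d 1))`. -/
theorem isLeast_energy_diagonal_of_two_le_add (h₀₁ : d 1 ≤ d 0) (h₁₂ : d 2 ≤ d 1) (h₂ : 0 ≤ d 2)
    (h : 2 ≤ d 0 + d 1) :
    IsLeast (Set.range fun S : Matrix.specialOrthogonalGroup (Fin 3) ℝ =>
        frobSq (symPart ((S : Matrix (Fin 3) (Fin 3) ℝ) * diagonal d - 1)))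
      (1 / 2 * (d 0 - d 1) ^ 2 + (d 2 - 1) ^ 2) := by
  constructor
  -- This cosine puts `u` at the vertex `(d 0 + d 1 - 2) / 2`, and a rotation about the third axis
  -- makes both Euler parameters in the bound vanish.
  · set c := 2 / (d 0 + d 1) with hc
    have hcs : c * (d 0 + d 1) = 2 := div_mul_cancel₀ _ (by linarith)
    have hc₀ : 0 ≤ c := div_nonneg zero_le_two (by linarith)
    have hc₁ : c ≤ 1 := (div_le_one (by linarith)).mpr h
    set s := √(1 - c ^ 2) with hs
    have hs₂ : s ^ 2 = 1 - c ^ 2 := Real.sq_sqrt (by nlinarith)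
    have hS : !![c, -s, 0; s, c, 0; 0, 0, 1] ∈ Matrix.specialOrthogonalGroup (Fin 3) ℝ := by
      rw [mem_specialOrthogonalGroup_iff_transpose_mul_self]
      constructor
      · ext i j
        fin_cases i <;> fin_cases j <;> simp [Matrix.mul_apply, Fin.sum_univ_three] <;>
          first | ring1 | linear_combination hs₂
      · rw [Matrix.det_fin_three]
        simp
        linear_combination hs₂
    refine ⟨⟨_, hS⟩, ?_⟩
    simp only [frobSq_symPart_mul_diagonal_sub_one]
    simp
    linear_combination (d 0 - d 1) ^ 2 / 2 * hs₂ + (c * (d 0 + d 1) - 2) / 2 * hcs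
  · rintro _ ⟨S, rfl⟩
    obtain ⟨hS, hdet⟩ := mem_specialOrthogonalGroup_iff_transpose_mul_self.mp S.2
    refine le_trans ?_ (le_frobSq_symPart_mul_diagonal_sub_one hS hdet h₀₁ h₁₂ h₂ rfl)
    set T : Matrix (Fin 3) (Fin 3) ℝ := S.1
    -- Completing the square: the term squared is `2u - (d 0 + d 1 - 2)`.
    linarith [sq_nonneg ((d 0 * (1 - T 0 0) + d 1 * (1 - T 1 1) + d 2 * (1 - T 2 2)) -
      (d 0 + d 1 - 2))]

end ReducedEnergy

end Cosserat

theorem mainTheorem4 (F : Matrix.GLPos (Fin 3) ℝ) (σ₁ σ₂ σ₃ : ℝ)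
    (hσ₁ : σ₁ = Cosserat.singularValue (Cosserat.toMat F) 0)
    (hσ₂ : σ₂ = Cosserat.singularValue (Cosserat.toMat F) 1)
    (hσ₃ : σ₃ = Cosserat.singularValue (Cosserat.toMat F) 2)
    (h₁₂ : σ₂ < σ₁) (h₂₃ : σ₃ < σ₂) (h₃ : 0 < σ₃) :
    -- the infimum that defines the reduced energy is a minimum
    IsLeast
      (Set.range fun R : Matrix.specialOrthogonalGroup (Fin 3) ℝ =>
        Cosserat.energyRel 1 0 (R : Matrix (Fin 3) (Fin 3) ℝ) (Cosserat.toMat F))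
      (Cosserat.reducedEnergy 1 0 F) ∧
    -- the two cases are membership in the classical and in the non-classical domain
    (F ∈ Cosserat.domClassical 1 0 ↔ σ₁ + σ₂ ≤ 2) ∧
    (F ∈ Cosserat.domNonclassical 1 0 ↔ 2 ≤ σ₁ + σ₂) ∧
    -- the classical piece
    (σ₁ + σ₂ ≤ 2 →
      Cosserat.reducedEnergy 1 0 F = (σ₁ - 1) ^ 2 + (σ₂ - 1) ^ 2 + (σ₃ - 1) ^ 2 ∧
      (σ₁ - 1) ^ 2 + (σ₂ - 1) ^ 2 + (σ₃ - 1) ^ 2 =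
        Cosserat.frobSq (Cosserat.stretch (Cosserat.toMat F) - 1)) ∧
    -- the non-classical piece
    (2 ≤ σ₁ + σ₂ →
      Cosserat.reducedEnergy 1 0 F = 1 / 2 * (σ₁ - σ₂) ^ 2 + (σ₃ - 1) ^ 2) := by
  set M := Cosserat.toMat F with hM
  have hdet : 0 < M.det := F.2
  have hpos : ∀ i, 0 < Cosserat.singularValue M i := by
    intro i
    fin_cases i
    · exact hσ₁ ▸ h₃.trans (h₂₃.trans h₁₂)
    · exact hσ₂ ▸ h₃.trans h₂₃
    · exact hσ₃ ▸ h₃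
  have hrange := Cosserat.range_energyRel_one_zero hdet hpos
  -- For `μ = 1`, `μc = 0` the scaling parameter is 1, so the domains test the strain of `F` itself.
  have hscale : (Cosserat.scalingParam 1 0)⁻¹ • M = M := by simp [Cosserat.scalingParam]
  have hstrain := Cosserat.maxMeanPlanarStrain_fin_three M
  have hclassical (h : σ₁ + σ₂ ≤ 2) := Cosserat.isLeast_energy_diagonal_of_add_le_two
    (hσ₂ ▸ hσ₁ ▸ h₁₂.le) (hσ₃ ▸ hσ₂ ▸ h₂₃.le) (hσ₃ ▸ h₃.le) (hσ₂ ▸ hσ₁ ▸ h)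
  have hnonclassical (h : 2 ≤ σ₁ + σ₂) := Cosserat.isLeast_energy_diagonal_of_two_le_add
    (hσ₂ ▸ hσ₁ ▸ h₁₂.le) (hσ₃ ▸ hσ₂ ▸ h₂₃.le) (hσ₃ ▸ h₃.le) (hσ₂ ▸ hσ₁ ▸ h)
  rw [← hrange, ← hσ₁, ← hσ₂, ← hσ₃] at hclassical hnonclassical
  rw [← hσ₁, ← hσ₂] at hstrain
  refine ⟨?_, ?_, ?_, fun h => ⟨(hclassical h).csInf_eq, ?_⟩, fun h => (hnonclassical h).csInf_eq⟩
  · have hmin {x : ℝ} (hx : IsLeast (Set.range fun R : Matrix.specialOrthogonalGroup (Fin 3) ℝ =>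
        Cosserat.energyRel 1 0 (R : Matrix (Fin 3) (Fin 3) ℝ) M) x) :
        Cosserat.reducedEnergy 1 0 F = x := hx.csInf_eq
    rcases le_total (σ₁ + σ₂) 2 with h | h
    · exact hmin (hclassical h) ▸ hclassical h
    · exact hmin (hnonclassical h) ▸ hnonclassical h
  · rw [Cosserat.domClassical, Set.mem_ofPred_eq, ← hM, hscale, hstrain]
    constructor <;> intro h <;> linarith
  · rw [Cosserat.domNonclassical, Set.mem_ofPred_eq, ← hM, hscale, hstrain]
    constructor <;> intro h <;> linarith
  · rw [Cosserat.frobSq_stretch_sub_one, Fin.sum_univ_three, ← hσ₁, ← hσ₂, ← hσ₃]
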